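/- Let $K:k$ be a quadratic field extension with an automorphism $\sigma:x\mapsto\bar x$ of $K$ over $k$ of order $2$, and let $l\ge 2$. Let $d=2l$, or $d=2l+1$ with $\operatorname{char}K\ne 2$ (characteristic $0$ allowed). Index rows and columns by $1,\dots,l,-1,\dots,-l$ if $d=2l$ and by $0,1,\dots,l,-1,\dots,-l$ if $d=2l+1$, and let $U(d,K)=\{X\in GL(d,K): {}^T\bar X\beta X=\beta\}$ be the split unitary group, where $\beta=\begin{pmatrix}0&I_l\\ I_l&0\end{pmatrix}$ if $d=2l$ and $\beta=\begin{pmatrix}2&0&0\\0&0&I_l\\0&I_l&0\end{pmatrix}$ if $d=2l+1$. With $e_{a,b}$ the matrix units, the elementary (Chevalley--Steinberg) matrices are, for $1\le i,j\le l$, $t\in K$ and $s\in K$ with $\bar s=-s$: $$x_{i,j}(t)=I+te_{i,j}-\bar te_{-j,-i}\ (i\ne j),\quad x_{i,-j}(t)=I+te_{i,-j}-\bar te_{j,-i}\ (i<j),\quad x_{-i,j}(t)=I+te_{-i,j}-\bar te_{-j,i}\ (i<j),$$ $$x_{i,-i}(s)=I+se_{i,-i},\qquad x_{-i,i}(s)=I+se_{-i,i},$$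 and, only if $d=2l+1$, also $$x_{i,0}(t)=I-2\bar te_{i,0}+te_{0,-i}-t\bar te_{i,-i},\qquad x_{0,i}(t)=I+te_{0,i}-2\bar te_{-i,0}-t\bar te_{-i,i}.$$ An elementary operation is the multiplication of a matrix on the left (row operation) or on the right (column operation) by an elementary matrix. Then every $A\in U(d,K)$ can be transformed, by a finite sequence of elementary operations, into a diagonal matrix $D$ of the form below, and $A=x_1x_2\cdots x_rD$ for some finite sequence of elementary matrices $x_1,\dots,x_r$ (and the same $D$). 1. If $d=2l$ (any characteristic), then $D=\operatorname{diag}(1,\dots,1,\lambda,1,\dots,1,\bar\lambda^{-1})$ for some $\lambda\in K\setminus\{0\}$ with $\lambda\bar\lambda^{-1}=\det A$; here $\lambda$ is in place $l$ and $\bar\lambda^{-1}$ in place $-l$. 2. If $d=2l+1$ (and $\operatorname{char}K\neq2$), then $D=\operatorname{diag}(\alpha,1,\dots,1,\lambda,1,\dots,1,\bar\lambda^{-1})$ for some $\alpha\in K$ and $\lambda\in K\setminus\{0\}$ with $\alpha\bar\alpha=1$ and $\alpha\lambda\bar\lambda^{-1}=\det A$; here $\alpha$ is in place $0$, $\lambda$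 in place $l$ and $\bar\lambda^{-1}$ in place $-l$. -/

import Mathlib

namespace SplitUnitary

/-- The conjugate transpose of `X` with respect to the field automorphism `σ : x ↦ x̄`. -/
def conjT {k K : Type*} [Field k] [Field K] [Algebra k K] (σ : K ≃ₐ[k] K)
    {n : Type*} (X : Matrix n n K) : Matrix n n K :=
  (X.map σ).transpose

theorem conjT_mul {k K : Type*} [Field k] [Field K] [Algebra k K] (σ : K ≃ₐ[k] K)
    {n : Type*} [Fintype n] (X Y : Matrix n n K) :
    conjT σ (X * Y) = conjT σ Y * conjT σ X := by
  ext i j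
  simp [conjT, Matrix.mul_apply, mul_comm]

theorem conjT_one {k K : Type*} [Field k] [Field K] [Algebra k K] (σ : K ≃ₐ[k] K)
    {n : Type*} [DecidableEq n] : conjT σ (1 : Matrix n n K) = 1 := by
  simp [conjT]

/-- The unitary group of the form with matrix `β`: all `X ∈ GL` with `X̄ᵀ β X = β`. -/
def unitary {k K : Type*} [Field k] [Field K] [Algebra k K] (σ : K ≃ₐ[k] K)
    {n : Type*} [Fintype n] [DecidableEq n] (β : Matrix n n K) :
    Subgroup (Matrix.GeneralLinearGroup n K) where
  carrier := {X | conjT σ (X : Matrix n n K) * β * (X : Matrix n n K) = β}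
  one_mem' := by simp [conjT_one]
  mul_mem' := by
    intro X Y hX hY
    simp only [Set.mem_ofPred_eq] at hX hY ⊢
    rw [Units.val_mul, conjT_mul]
    calc conjT σ (Y : Matrix n n K) * conjT σ (X : Matrix n n K) * β *
          ((X : Matrix n n K) * (Y : Matrix n n K))
        = conjT σ (Y : Matrix n n K) *
          (conjT σ (X : Matrix n n K) * β * (X : Matrix n n K)) * (Y : Matrix n n K) := by
          simp only [Matrix.mul_assoc]
      _ = β := by rw [hX, hY]
  inv_mem' := by
    intro X hX
    simp only [Set.mem_ofPred_eq] at hX ⊢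
    have h1 : (X : Matrix n n K) * ((X⁻¹ : Matrix.GeneralLinearGroup n K) : Matrix n n K) = 1 := by
      rw [← Units.val_mul, mul_inv_cancel, Units.val_one]
    have h2 : conjT σ ((X⁻¹ : Matrix.GeneralLinearGroup n K) : Matrix n n K) *
        conjT σ (X : Matrix n n K) = 1 := by
      rw [← conjT_mul, h1, conjT_one]
    generalize ((X⁻¹ : Matrix.GeneralLinearGroup n K) : Matrix n n K) = Y at h1 h2 ⊢
    calc conjT σ Y * β * Y
        = conjT σ Y * (conjT σ (X : Matrix n n K) * β * (X : Matrix n n K)) * Y := by rw [hX]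
      _ = (conjT σ Y * conjT σ (X : Matrix n n K)) * β * ((X : Matrix n n K) * Y) := by
          simp only [Matrix.mul_assoc]
      _ = β := by rw [h1, h2, Matrix.one_mul, Matrix.mul_one]

/-- One elementary operation: `h` arises from `g` by multiplying it on the left (row operation)
or on the right (column operation) by a matrix satisfying `E`. -/
def ElemOp {K : Type*} [Field K] {n : Type*} [Fintype n] (E : Matrix n n K → Prop)
    (g h : Matrix n n K) : Prop :=
  ∃ x, E x ∧ (h = x * g ∨ h = g * x)

/-! ### Even order `d = 2l` -/

/-- The indices `1, …, l, -1, …, -l`. -/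
abbrev EvenIndex (l : ℕ) : Type := Fin l ⊕ Fin l

namespace EvenIndex

/-- The index `i`. -/
abbrev pos {l : ℕ} (i : Fin l) : EvenIndex l := Sum.inl i

/-- The index `-i`. -/
abbrev neg {l : ℕ} (i : Fin l) : EvenIndex l := Sum.inr i

end EvenIndex

/-- The form `β = (0, I; I, 0)` of size `2l`. -/
def evenForm (K : Type*) [Field K] (l : ℕ) : Matrix (EvenIndex l) (EvenIndex l) K :=
  Matrix.fromBlocks 0 1 1 0

/-- The split unitary group `U(2l, K)`. -/
def evenU {k K : Type*} [Field k] [Field K] [Algebra k K] (σ : K ≃ₐ[k] K) (l : ℕ) :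
    Subgroup (Matrix.GeneralLinearGroup (EvenIndex l) K) :=
  unitary σ (evenForm K l)

open Matrix EvenIndex in
/-- The elementary (Chevalley–Steinberg) matrices of `U(2l, K)`. Here `single a b t` is
`t e_{a,b}`. -/
inductive EvenElem {k K : Type*} [Field k] [Field K] [Algebra k K] (σ : K ≃ₐ[k] K) (l : ℕ) :
    Matrix (EvenIndex l) (EvenIndex l) K → Prop
  /-- `x_{i,j}(t)` for `i ≠ j` -/
  | pos_pos (i j : Fin l) (hij : i ≠ j) (t : K) :
      EvenElem σ l (1 + single (pos i) (pos j) t - single (neg j) (neg i) (σ t))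
  /-- `x_{i,-j}(t)` for `i < j` -/
  | pos_neg (i j : Fin l) (hij : i < j) (t : K) :
      EvenElem σ l (1 + single (pos i) (neg j) t - single (pos j) (neg i) (σ t))
  /-- `x_{-i,j}(t)` for `i < j` -/
  | neg_pos (i j : Fin l) (hij : i < j) (t : K) :
      EvenElem σ l (1 + single (neg i) (pos j) t - single (neg j) (pos i) (σ t))
  /-- `x_{i,-i}(s)` with `s̄ = -s` -/
  | pos_neg_self (i : Fin l) (s : K) (hs : σ s = -s) :
      EvenElem σ l (1 + single (pos i) (neg i) s)
  /-- `x_{-i,i}(s)` with `s̄ = -s` -/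
  | neg_pos_self (i : Fin l) (s : K) (hs : σ s = -s) :
      EvenElem σ l (1 + single (neg i) (pos i) s)

/-- The matrix `diag(1, …, 1, c, 1, …, 1, c̄⁻¹)` with `c` in place `l` and `c̄⁻¹` in
place `-l`. -/
def evenDiag {k K : Type*} [Field k] [Field K] [Algebra k K] (σ : K ≃ₐ[k] K) (l : ℕ) (c : K) :
    Matrix (EvenIndex l) (EvenIndex l) K :=
  Matrix.diagonal (Sum.elim
    (fun i : Fin l => if (i : ℕ) + 1 = l then c else 1)
    (fun i : Fin l => if (i : ℕ) + 1 = l then (σ c)⁻¹ else 1))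

/-! ### Odd order `d = 2l + 1` -/

/-- The indices `0, 1, …, l, -1, …, -l`. -/
abbrev OddIndex (l : ℕ) : Type := Unit ⊕ (Fin l ⊕ Fin l)

namespace OddIndex

/-- The index `0`. -/
abbrev zero {l : ℕ} : OddIndex l := Sum.inl ()

/-- The index `i`. -/
abbrev pos {l : ℕ} (i : Fin l) : OddIndex l := Sum.inr (Sum.inl i)

/-- The index `-i`. -/
abbrev neg {l : ℕ} (i : Fin l) : OddIndex l := Sum.inr (Sum.inr i)

end OddIndex

/-- The form `β = (2, 0, 0; 0, 0, I; 0, I, 0)` of size `2l + 1`. -/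
def oddForm (K : Type*) [Field K] (l : ℕ) : Matrix (OddIndex l) (OddIndex l) K :=
  Matrix.fromBlocks (Matrix.diagonal fun _ => 2) 0 0 (Matrix.fromBlocks 0 1 1 0)

/-- The split unitary group `U(2l + 1, K)`. -/
def oddU {k K : Type*} [Field k] [Field K] [Algebra k K] (σ : K ≃ₐ[k] K) (l : ℕ) :
    Subgroup (Matrix.GeneralLinearGroup (OddIndex l) K) :=
  unitary σ (oddForm K l)

open Matrix OddIndex in
/-- The elementary (Chevalley–Steinberg) matrices of `U(2l + 1, K)`. Here `single a b t` is
`t e_{a,b}`. -/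
inductive OddElem {k K : Type*} [Field k] [Field K] [Algebra k K] (σ : K ≃ₐ[k] K) (l : ℕ) :
    Matrix (OddIndex l) (OddIndex l) K → Prop
  /-- `x_{i,j}(t)` for `i ≠ j` -/
  | pos_pos (i j : Fin l) (hij : i ≠ j) (t : K) :
      OddElem σ l (1 + single (pos i) (pos j) t - single (neg j) (neg i) (σ t))
  /-- `x_{i,-j}(t)` for `i < j` -/
  | pos_neg (i j : Fin l) (hij : i < j) (t : K) :
      OddElem σ l (1 + single (pos i) (neg j) t - single (pos j) (neg i) (σ t))
  /-- `x_{-i,j}(t)` for `i < j` -/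
  | neg_pos (i j : Fin l) (hij : i < j) (t : K) :
      OddElem σ l (1 + single (neg i) (pos j) t - single (neg j) (pos i) (σ t))
  /-- `x_{i,-i}(s)` with `s̄ = -s` -/
  | pos_neg_self (i : Fin l) (s : K) (hs : σ s = -s) :
      OddElem σ l (1 + single (pos i) (neg i) s)
  /-- `x_{-i,i}(s)` with `s̄ = -s` -/
  | neg_pos_self (i : Fin l) (s : K) (hs : σ s = -s) :
      OddElem σ l (1 + single (neg i) (pos i) s)
  /-- `x_{i,0}(t)` -/
  | pos_zero (i : Fin l) (t : K) :
      OddElem σ l (1 - single (pos i) zero (2 * σ t) + single zero (neg i) t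
        - single (pos i) (neg i) (t * σ t))
  /-- `x_{0,i}(t)` -/
  | zero_pos (i : Fin l) (t : K) :
      OddElem σ l (1 + single zero (pos i) t - single (neg i) zero (2 * σ t)
        - single (neg i) (pos i) (t * σ t))

/-- The matrix `diag(a, 1, …, 1, c, 1, …, 1, c̄⁻¹)` with `a` in place `0`, `c` in place `l` and
`c̄⁻¹` in place `-l`. -/
def oddDiag {k K : Type*} [Field k] [Field K] [Algebra k K] (σ : K ≃ₐ[k] K) (l : ℕ) (a c : K) :
    Matrix (OddIndex l) (OddIndex l) K :=
  Matrix.diagonal (Sum.elim (fun _ => a) (Sum.elim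
    (fun i : Fin l => if (i : ℕ) + 1 = l then c else 1)
    (fun i : Fin l => if (i : ℕ) + 1 = l then (σ c)⁻¹ else 1)))

end SplitUnitary

set_option linter.unusedSectionVars false

/-! Both parities are one statement about an involution `ν` of the index set with at most one fixed
point: `Sum.swap` for even order, `oddNeg` for odd order, where the fixed index has weight 2. Row
operations alone suffice, and the pairs `{a, ν a}` are treated one at a time.

The column of an isometry at a non-fixed index `a` is nonzero and isotropic. A second pair serves as
auxiliary room to make its entry at `a` equal to 1 (`exists_apply_eq_one`). That entry then clears
all others: ordinary and short root elements kill everything off the pair, and isotropy says that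
the last entry, at `ν a`, is a skew multiple of the pivot, so a long root element removes it
(`exists_clear`). The column at `ν a` is cleared the same way without disturbing the first
(`exists_plane`). Finished pairs stay finished because later factors lie in `fixing σ ν F`: an
isometry fixing `e_d` also preserves the coordinate `ν d`.

The pair `j` kept in reserve comes last. No auxiliary pair is left for it, so its pivot is only made
nonzero, which leaves `c` and `(σ c)⁻¹`. Orthogonality to the other columns makes the column at the
fixed index diagonal, with an entry of norm 1. Root elements have determinant 1 and root elements as
inverses, which gives the determinant formula and the factorization. -/

namespace SplitUnitary

open Matrix

/-! ### Root elements for an involution of the index set. -/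

section RootElements

variable {k K n : Type*} [Field k] [Field K] [Algebra k K] [Fintype n] [DecidableEq n]

/-- The weight `2` at fixed points of `ν` and `1` elsewhere. -/
def formWeight (K : Type*) [Field K] (ν : n → n) (a : n) : K := if ν a = a then 2 else 1

/-- The matrix of the hermitian form pairing `e_a` with `e_{ν a}`, with value `2` on fixed points
of `ν`. -/
def pairForm (K : Type*) [Field K] (ν : n → n) : Matrix n n K :=
  Matrix.of fun a b => if b = ν a then formWeight K ν a else 0

/-- The root elements attached to an involution `ν` of the index set. -/
inductive RootElem (σ : K ≃ₐ[k] K) (ν : n → n) : Matrix n n K → Prop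
  | root (a b : n) (ha : ν a ≠ a) (hb : ν b ≠ b) (hab : a ≠ b) (hab' : ν a ≠ b) (t : K) :
      RootElem σ ν (1 + single a b t - single (ν b) (ν a) (σ t))
  | long (a : n) (ha : ν a ≠ a) (s : K) (hs : σ s = -s) :
      RootElem σ ν (1 + single a (ν a) s)
  | short (z a : n) (hz : ν z = z) (ha : ν a ≠ a) (t : K) :
      RootElem σ ν (1 - single a z (2 * σ t) + single z (ν a) t - single a (ν a) (t * σ t))

theorem conjT_add (σ : K ≃ₐ[k] K) (X Y : Matrix n n K) :
    conjT σ (X + Y) = conjT σ X + conjT σ Y := by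
  ext i j; simp [conjT]

theorem conjT_sub (σ : K ≃ₐ[k] K) (X Y : Matrix n n K) :
    conjT σ (X - Y) = conjT σ X - conjT σ Y := by
  ext i j; simp [conjT]

theorem conjT_single (σ : K ≃ₐ[k] K) (a b : n) (t : K) :
    conjT σ (single a b t) = single b a (σ t) := by
  ext i j
  simp only [conjT, transpose_apply, map_apply, single_apply]
  by_cases h : a = j ∧ b = i
  · rw [if_pos h, if_pos h.symm]
  · rw [if_neg h, if_neg (fun h' => h h'.symm), map_zero]

theorem single_mul_pairForm (ν : n → n) (a b : n) (t : K) :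
    single a b t * pairForm K ν = single a (ν b) (t * formWeight K ν b) := by
  ext i j
  by_cases hi : a = i
  · subst hi
    simp [pairForm, single_apply, eq_comm]
  · rw [single_mul_apply_of_ne _ _ _ _ _ (Ne.symm hi)]
    simp [hi]

theorem pairForm_mul_single {ν : n → n} (hν : Function.Involutive ν) (a b : n) (t : K) :
    pairForm K ν * single a b t = single (ν a) b (formWeight K ν a * t) := by
  ext i j
  by_cases hj : b = j
  · subst hj
    by_cases hi : a = ν i
    · subst hi
      simp [pairForm, formWeight, hν i, hν.eq_iff]
    · have : ν a ≠ i := fun h => hi (by rw [← h, hν])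
      simp [pairForm, hi, this]
  · rw [mul_single_apply_of_ne _ _ _ _ _ (Ne.symm hj)]
    simp [hj]

theorem formWeight_of_ne {ν : n → n} {a : n} (ha : ν a ≠ a) : formWeight K ν a = 1 := if_neg ha

theorem formWeight_of_eq {ν : n → n} {a : n} (ha : ν a = a) : formWeight K ν a = 2 := if_pos ha

theorem RootElem.isometry {σ : K ≃ₐ[k] K} (hσ : ∀ x, σ (σ x) = x) {ν : n → n}
    (hν : Function.Involutive ν) {x : Matrix n n K} (hx : RootElem σ ν x) :
    conjT σ x * pairForm K ν * x = pairForm K ν := by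
  rw [Matrix.mul_assoc]
  cases hx with
  | root a b ha hb hab hab' t =>
    have hνb : ν (ν b) ≠ ν b := fun h => hb (hν.injective h)
    have h1 : ν b ≠ ν a := fun h => hab (hν.injective h).symm
    simp only [conjT_add, conjT_sub, conjT_one, conjT_single, Matrix.mul_add, Matrix.mul_sub,
      Matrix.add_mul, Matrix.sub_mul, pairForm_mul_single hν,
      single_mul_pairForm, formWeight_of_ne ha, formWeight_of_ne hνb, hν b, hσ, one_mul, mul_one]
    rw [single_mul_single_of_ne _ _ _ _ ha.symm, single_mul_single_of_ne _ _ _ _ hab,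
      single_mul_single_of_ne _ _ _ _ h1, single_mul_single_of_ne _ _ _ _ hb]
    abel
  | long a ha s hs =>
    simp only [conjT_add, conjT_one, conjT_single, Matrix.mul_add,
      Matrix.add_mul, pairForm_mul_single hν,
      single_mul_pairForm, formWeight_of_ne ha, one_mul, mul_one, hs]
    rw [single_mul_single_of_ne _ _ _ _ ha.symm, add_zero, add_assoc, ← single_add]
    simp
  | short z a hz ha t =>
    have haz : a ≠ z := fun h => ha (h ▸ hz)
    have hνaz : ν a ≠ z := fun h => ha (hν.injective (by rw [h, hz]))
    simp only [conjT_add, conjT_sub, conjT_one, conjT_single, Matrix.mul_add, Matrix.mul_sub,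
      Matrix.add_mul, Matrix.sub_mul, pairForm_mul_single hν,
      single_mul_pairForm, formWeight_of_ne ha, formWeight_of_eq hz,
      hz, hσ, one_mul, mul_one, map_mul, map_ofNat, single_mul_single_same]
    simp only [single_mul_single_of_ne _ _ _ _ ha.symm, single_mul_single_of_ne _ _ _ _ haz,
      single_mul_single_of_ne _ _ _ _ hνaz.symm]
    -- The weight 2 at `z` contributes `2 * t * σ t` to the norm of the image of `e_{ν a}`; the
    -- coefficient `-(t * σ t)` at `a` enters twice and cancels it.
    ext i j
    simp only [Matrix.add_apply, Matrix.sub_apply, single_apply, Matrix.zero_apply]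
    split_ifs <;> ring

/-- Each root element is a product of transvections. -/
theorem RootElem.det_eq_one {σ : K ≃ₐ[k] K} {ν : n → n}
    (hν : Function.Involutive ν) {x : Matrix n n K} (hx : RootElem σ ν x) : x.det = 1 := by
  cases hx with
  | root a b ha hb hab hab' t =>
    have h1 : ν b ≠ ν a := fun h => hab (hν.injective h).symm
    have : 1 + single a b t - single (ν b) (ν a) (σ t) =
        transvection a b t * transvection (ν b) (ν a) (-σ t) := by
      rw [transvection, transvection, Matrix.mul_add, Matrix.mul_one, Matrix.add_mul,
        Matrix.one_mul, single_mul_single_of_ne _ _ _ _ hb.symm, add_zero, sub_eq_add_neg,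
        ← single_neg]
    rw [this, det_mul, det_transvection_of_ne _ _ hab, det_transvection_of_ne _ _ h1, one_mul]
  | long a ha s hs => exact det_transvection_of_ne _ _ ha.symm s
  | short z a hz ha t =>
    have haz : a ≠ z := fun h => ha (h ▸ hz)
    have hνaz : z ≠ ν a := fun h => ha (hν.injective (by rw [← h, hz]))
    have : 1 - single a z (2 * σ t) + single z (ν a) t - single a (ν a) (t * σ t) =
        transvection z (ν a) t * transvection a z (-(2 * σ t)) *
          transvection a (ν a) (-(t * σ t)) := by
      simp only [transvection, Matrix.mul_add, Matrix.mul_one, Matrix.add_mul,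
        Matrix.one_mul, single_mul_single_of_ne _ _ _ _ ha,
        single_mul_single_of_ne _ _ _ _ haz.symm, ← single_neg, Matrix.mul_neg, Matrix.neg_mul,
        add_zero, neg_zero]
      abel
    rw [this, det_mul, det_mul, det_transvection_of_ne _ _ hνaz, det_transvection_of_ne _ _ haz,
      det_transvection_of_ne _ _ ha.symm, one_mul, one_mul]

/-- The inverse has the negated parameter. This turns a reduction `g * A = D` into a factorization
of `A` by elements of the same kind. -/
theorem RootElem.exists_inv {σ : K ≃ₐ[k] K} {ν : n → n}
    (hν : Function.Involutive ν) {x : Matrix n n K} (hx : RootElem σ ν x) :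
    ∃ y, RootElem σ ν y ∧ x * y = 1 := by
  cases hx with
  | root a b ha hb hab hab' t =>
    refine ⟨_, .root a b ha hb hab hab' (-t), ?_⟩
    have h1 : ν a ≠ ν b := fun h => hab (hν.injective h)
    simp only [Matrix.mul_add, Matrix.mul_one, Matrix.add_mul, Matrix.sub_mul,
        Matrix.one_mul, single_mul_single_of_ne _ _ _ _ hb.symm,
        single_mul_single_of_ne _ _ _ _ hab.symm, single_mul_single_of_ne _ _ _ _ ha,
        single_mul_single_of_ne _ _ _ _ h1, map_neg, ← single_neg,
        Matrix.mul_neg, sub_neg_eq_add]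
    abel
  | long a ha s hs =>
    refine ⟨_, .long a ha (-s) (by simp [hs]), ?_⟩
    simp only [Matrix.mul_add, Matrix.mul_one, Matrix.add_mul,
        Matrix.one_mul, single_mul_single_of_ne _ _ _ _ ha, ← single_neg, Matrix.mul_neg]
    abel
  | short z a hz ha t =>
    refine ⟨_, .short z a hz ha (-t), ?_⟩
    have haz : a ≠ z := fun h => ha (h ▸ hz)
    have hνaz : ν a ≠ z := fun h => ha (hν.injective (by rw [h, hz]))
    simp only [Matrix.mul_add, Matrix.mul_sub, Matrix.mul_one, Matrix.add_mul, Matrix.sub_mul,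
        Matrix.one_mul, single_mul_single_of_ne _ _ _ _ ha, single_mul_single_of_ne _ _ _ _ haz.symm,
        single_mul_single_of_ne _ _ _ _ hνaz, single_mul_single_same, map_neg]
    ext i j
    simp only [Matrix.add_apply, Matrix.sub_apply, single_apply, Matrix.zero_apply]
    split_ifs <;> ring

/-! ### The hermitian form and products of root elements fixing basis vectors. -/

/-- The hermitian form with matrix `pairForm`. -/
def herm (σ : K ≃ₐ[k] K) (ν : n → n) (v w : n → K) : K :=
  (fun i => σ (v i)) ⬝ᵥ (pairForm K ν *ᵥ w)

theorem herm_eq_sum (σ : K ≃ₐ[k] K) (ν : n → n) (v w : n → K) :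
    herm σ ν v w = ∑ a, σ (v a) * (formWeight K ν a * w (ν a)) := by
  simp [herm, dotProduct, mulVec, pairForm]

theorem herm_single_left (σ : K ≃ₐ[k] K) (ν : n → n) (d : n) (c : K) (w : n → K) :
    herm σ ν (Pi.single d c) w = σ c * (formWeight K ν d * w (ν d)) := by
  rw [herm_eq_sum, Finset.sum_eq_single d] <;> simp +contextual

theorem herm_mulVec {σ : K ≃ₐ[k] K} {ν : n → n} {X : Matrix n n K}
    (hX : conjT σ X * pairForm K ν * X = pairForm K ν) (v w : n → K) :
    herm σ ν (X *ᵥ v) (X *ᵥ w) = herm σ ν v w := by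
  have h : (fun i => σ ((X *ᵥ v) i)) = (fun i => σ (v i)) ᵥ* conjT σ X := by
    ext i
    simp [mulVec, vecMul, dotProduct, conjT, mul_comm]
  conv_rhs => rw [herm, ← hX]
  rw [herm, h, ← dotProduct_mulVec, mulVec_mulVec, mulVec_mulVec, Matrix.mul_assoc]

theorem isometry_mul {σ : K ≃ₐ[k] K} {β X Y : Matrix n n K} (hX : conjT σ X * β * X = β)
    (hY : conjT σ Y * β * Y = β) : conjT σ (X * Y) * β * (X * Y) = β := by
  rw [conjT_mul]
  calc _ = conjT σ Y * (conjT σ X * β * X) * Y := by simp only [Matrix.mul_assoc]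
    _ = β := by rw [hX, hY]

/-- Products of root elements that fix the basis vectors with index in `F`. -/
def fixing (σ : K ≃ₐ[k] K) (ν : n → n) (F : Set n) : Submonoid (Matrix n n K) where
  carrier := {g | g ∈ Submonoid.closure {x | RootElem σ ν x} ∧
    ∀ d ∈ F, g *ᵥ Pi.single d 1 = Pi.single d 1}
  one_mem' := ⟨one_mem _, fun _ _ => one_mulVec _⟩
  mul_mem' := fun {g h} hg hh => ⟨mul_mem hg.1 hh.1, fun d hd => by
    rw [← mulVec_mulVec, hh.2 d hd, hg.2 d hd]⟩

theorem fixing_anti (σ : K ≃ₐ[k] K) (ν : n → n) {F G : Set n} (h : F ⊆ G) :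
    fixing σ ν G ≤ fixing σ ν F := fun _ hg => ⟨hg.1, fun d hd => hg.2 d (h hd)⟩

theorem isometry_of_mem_closure {σ : K ≃ₐ[k] K} (hσ : ∀ x, σ (σ x) = x) {ν : n → n}
    (hν : Function.Involutive ν) {g : Matrix n n K}
    (hg : g ∈ Submonoid.closure {x | RootElem σ ν x}) :
    conjT σ g * pairForm K ν * g = pairForm K ν := by
  induction hg using Submonoid.closure_induction with
  | mem x hx => exact hx.isometry hσ hν
  | one => simp [conjT_one]
  | mul x y _ _ hx hy => exact isometry_mul hx hy

theorem formWeight_ne_zero {ν : n → n} (hq : ∀ a, ν a = a → (2 : K) ≠ 0) (a : n) :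
    formWeight K ν a ≠ 0 := by
  unfold formWeight
  split_ifs with h
  · exact hq a h
  · exact one_ne_zero

/-- An isometry fixing `e_d` preserves the coordinate `ν d`. -/
theorem mulVec_apply_of_fix {σ : K ≃ₐ[k] K} {ν : n → n} (hq : ∀ a, ν a = a → (2 : K) ≠ 0)
    {X : Matrix n n K} (hX : conjT σ X * pairForm K ν * X = pairForm K ν) {d : n}
    (hd : X *ᵥ Pi.single d 1 = Pi.single d 1) (v : n → K) : (X *ᵥ v) (ν d) = v (ν d) := by
  have h := herm_mulVec hX (Pi.single d 1) v
  rw [hd, herm_single_left, herm_single_left] at h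
  simpa [formWeight_ne_zero hq d] using h

theorem root_mulVec_apply (σ : K ≃ₐ[k] K) (ν : n → n) (a b : n) (t : K) (v : n → K) (d : n) :
    ((1 + single a b t - single (ν b) (ν a) (σ t)) *ᵥ v) d =
      v d + (if d = a then t * v b else 0) - (if d = ν b then σ t * v (ν a) else 0) := by
  simp [add_mulVec, sub_mulVec, single_mulVec, Function.update_apply]

theorem long_mulVec_apply (ν : n → n) (a : n) (s : K) (v : n → K) (d : n) :
    ((1 + single a (ν a) s) *ᵥ v) d = v d + (if d = a then s * v (ν a) else 0) := by
  simp [add_mulVec, single_mulVec, Function.update_apply]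

theorem short_mulVec_apply (σ : K ≃ₐ[k] K) (ν : n → n) (z a : n) (t : K) (v : n → K) (d : n) :
    ((1 - single a z (2 * σ t) + single z (ν a) t - single a (ν a) (t * σ t)) *ᵥ v) d =
      v d - (if d = a then 2 * σ t * v z else 0) + (if d = z then t * v (ν a) else 0)
        - (if d = a then t * σ t * v (ν a) else 0) := by
  simp [add_mulVec, sub_mulVec, single_mulVec, Function.update_apply]

end RootElements

/-! ### Clearing an isotropic vector. -/

section Reduction

variable {k K n : Type*} [Field k] [Field K] [Algebra k K] [Fintype n] [DecidableEq n]
  {σ : K ≃ₐ[k] K} {ν : n → n}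

theorem root_mem_fixing {a b : n} (ha : ν a ≠ a) (hb : ν b ≠ b) (hab : a ≠ b) (hab' : ν a ≠ b)
    (t : K) {F : Set n} (hbF : b ∉ F) (haF : ν a ∉ F) :
    1 + single a b t - single (ν b) (ν a) (σ t) ∈ fixing σ ν F := by
  refine ⟨Submonoid.subset_closure (.root a b ha hb hab hab' t), fun d hd => ?_⟩
  have h1 : b ≠ d := fun h => hbF (h ▸ hd)
  have h2 : ν a ≠ d := fun h => haF (h ▸ hd)
  ext i
  rw [root_mulVec_apply, Pi.single_eq_of_ne h1, Pi.single_eq_of_ne h2]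
  simp

theorem long_mem_fixing {a : n} (ha : ν a ≠ a) {s : K} (hs : σ s = -s) {F : Set n}
    (haF : ν a ∉ F) : 1 + single a (ν a) s ∈ fixing σ ν F := by
  refine ⟨Submonoid.subset_closure (.long a ha s hs), fun d hd => ?_⟩
  have h2 : ν a ≠ d := fun h => haF (h ▸ hd)
  ext i
  rw [long_mulVec_apply, Pi.single_eq_of_ne h2]
  simp

theorem short_mem_fixing {z a : n} (hz : ν z = z) (ha : ν a ≠ a) (t : K) {F : Set n}
    (hzF : z ∉ F) (haF : ν a ∉ F) :
    1 - single a z (2 * σ t) + single z (ν a) t - single a (ν a) (t * σ t) ∈ fixing σ ν F := by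
  refine ⟨Submonoid.subset_closure (.short z a hz ha t), fun d hd => ?_⟩
  have h1 : z ≠ d := fun h => hzF (h ▸ hd)
  have h2 : ν a ≠ d := fun h => haF (h ▸ hd)
  ext i
  rw [short_mulVec_apply, Pi.single_eq_of_ne h1, Pi.single_eq_of_ne h2]
  simp

theorem herm_mulVec_of_mem_fixing (hσ : ∀ x, σ (σ x) = x) (hν : Function.Involutive ν) {F : Set n}
    {g : Matrix n n K} (hg : g ∈ fixing σ ν F) (v w : n → K) :
    herm σ ν (g *ᵥ v) (g *ᵥ w) = herm σ ν v w :=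
  herm_mulVec (isometry_of_mem_closure hσ hν hg.1) v w

theorem mulVec_apply_of_mem_fixing (hσ : ∀ x, σ (σ x) = x) (hν : Function.Involutive ν)
    (hq : ∀ a, ν a = a → (2 : K) ≠ 0) {F : Set n} {g : Matrix n n K} (hg : g ∈ fixing σ ν F)
    {d : n} (hd : ν d ∈ F) (v : n → K) : (g *ᵥ v) d = v d := by
  have := mulVec_apply_of_fix hq (isometry_of_mem_closure hσ hν hg.1) (hg.2 _ hd) v
  rwa [hν] at this

/-- The entries of `v` at finitely many indices can be cleared with a nonzero entry `v a`. -/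
theorem exists_clear_finset (hσ : ∀ x, σ (σ x) = x) (hν : Function.Involutive ν)
    (hq : ∀ a, ν a = a → (2 : K) ≠ 0) {F : Set n}
    {a : n} (haF : a ∉ F) (ha : ν a ≠ a) {v : n → K} (hva : v a ≠ 0) (U : Finset n)
    (hU : ∀ b ∈ U, b ≠ a ∧ b ≠ ν a ∧ ν b ∉ F) :
    ∃ g ∈ fixing σ ν (insert (ν a) F), ∀ b ∈ U, (g *ᵥ v) b = 0 := by
  induction U using Finset.induction_on with
  | empty => exact ⟨1, one_mem _, by simp⟩
  | insert b U hbU ih =>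
    obtain ⟨g, hg, hgU⟩ := ih fun c hc => hU c (Finset.mem_insert_of_mem hc)
    obtain ⟨hba, hbνa, hbF⟩ := hU b (Finset.mem_insert_self _ _)
    have hwa : (g *ᵥ v) a = v a := mulVec_apply_of_mem_fixing hσ hν hq hg (Set.mem_insert _ _) v
    have ha' : a ∉ insert (ν a) F := by simp [ha.symm, haF]
    have hb' : ν b ∉ insert (ν a) F := by simp [hν.injective.eq_iff, hba, hbF]
    have hUa : ∀ d ∈ insert b U, d ≠ ν a := fun d hd => (hU d hd).2.1
    -- One root element changes the entry at `b` by a multiple of the pivot; its only side effect is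
    -- at `ν a`, an entry that `U` excludes.
    suffices ∃ x ∈ fixing σ ν (insert (ν a) F), ∀ d, d ≠ ν a →
        (x *ᵥ (g *ᵥ v)) d = (g *ᵥ v) d + if d = b then -(g *ᵥ v) b / v a * v a else 0 by
      obtain ⟨x, hx, hxv⟩ := this
      refine ⟨x * g, mul_mem hx hg, fun d hd => ?_⟩
      rw [← mulVec_mulVec, hxv d (hUa d hd)]
      split_ifs with h
      · rw [h, div_mul_cancel₀ _ hva, add_neg_cancel]
      · rw [add_zero, hgU d ((Finset.mem_insert.1 hd).resolve_left h)]
    -- A fixed index is reached by a short root element based at `ν a`, any other index by an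
    -- ordinary one.
    by_cases hb : ν b = b
    · refine ⟨_, short_mem_fixing hb (a := ν a) (fun h => ha (hν.injective h))
        (-(g *ᵥ v) b / v a) (hb ▸ hb') (by rwa [hν]), fun d hd => ?_⟩
      rw [short_mulVec_apply, hν, hwa]
      simp [hd]
    · refine ⟨_, root_mem_fixing hb ha hba (fun h => hbνa (by rw [← h, hν]))
        (-(g *ᵥ v) b / v a) ha' hb', fun d hd => ?_⟩
      rw [root_mulVec_apply, hwa]
      simp [hd]

/-- An isotropic vector `v` with `v a ≠ 0` is moved to `v a • e_a`. -/
theorem exists_clear (hσ : ∀ x, σ (σ x) = x) (hν : Function.Involutive ν)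
    (hq : ∀ a, ν a = a → (2 : K) ≠ 0) {F : Set n} (hF : ∀ d ∈ F, ν d ∈ F)
    {a : n} (haF : a ∉ F) (ha : ν a ≠ a) {v : n → K} (hva : v a ≠ 0) (hvF : ∀ d ∈ F, v d = 0)
    (hv : herm σ ν v v = 0) :
    ∃ g ∈ fixing σ ν (insert (ν a) F), g *ᵥ v = Pi.single a (v a) := by
  classical
  have hF' : ∀ d, ν d ∈ F → d ∈ F := fun d hd => by simpa [hν d] using hF _ hd
  obtain ⟨g, hg, hgU⟩ := exists_clear_finset hσ hν hq haF ha hva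
    {b | b ≠ a ∧ b ≠ ν a ∧ ν b ∉ F} (by simp)
  have hwa : (g *ᵥ v) a = v a := mulVec_apply_of_mem_fixing hσ hν hq hg (Set.mem_insert _ _) v
  have hνa : ν (ν a) ≠ ν a := fun h => ha (hν.injective h)
  have hw : ∀ d, d ≠ a → d ≠ ν a → (g *ᵥ v) d = 0 := by
    intro d h1 h2
    by_cases hd : ν d ∈ F
    · rw [mulVec_apply_of_mem_fixing hσ hν hq hg (Set.mem_insert_of_mem _ hd),
        hvF d (hF' d hd)]
    · exact hgU d (by simp [h1, h2, hd])
  -- Only the entries at `a` and `ν a` survive, so isotropy makes their quotient skew: exactly the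
  -- parameter condition of a long root element.
  have hh : σ (v a) * (g *ᵥ v) (ν a) + σ ((g *ᵥ v) (ν a)) * v a = 0 := by
    rw [← herm_mulVec_of_mem_fixing hσ hν hg, herm_eq_sum, ← Finset.sum_subset
      (Finset.subset_univ {a, ν a}), Finset.sum_pair ha.symm, hν, hwa, formWeight_of_ne ha,
      formWeight_of_ne hνa, one_mul, one_mul] at hv
    · exact hv
    · intro d _ hd
      simp only [Finset.mem_insert, Finset.mem_singleton, not_or] at hd
      rw [hw d hd.1 hd.2, map_zero, zero_mul]
  have hσa : σ (v a) ≠ 0 := by simpa using hva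
  have hs : σ (-(g *ᵥ v) (ν a) / v a) = -(-(g *ᵥ v) (ν a) / v a) := by
    rw [map_div₀, map_neg]
    field_simp
    linear_combination -hh
  have hx := long_mem_fixing (σ := σ) (F := insert (ν a) F) hνa hs
    (by rw [hν]; simp [ha.symm, haF])
  refine ⟨_, mul_mem hx hg, ?_⟩
  ext d
  rw [← mulVec_mulVec, long_mulVec_apply, hν, hwa]
  by_cases h1 : d = a
  · subst h1
    simp [ha.symm, hwa]
  · by_cases h2 : d = ν a
    · subst h2
      simp [ha, div_mul_cancel₀ _ hva]
    · simp [h1, h2, hw d h1 h2]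

/-- A nonzero isotropic vector has a nonzero entry outside the fixed point of `ν`. -/
theorem exists_apply_ne_zero (hq : ∀ a, ν a = a → (2 : K) ≠ 0)
    (hZ : ∀ y z, ν y = y → ν z = z → y = z) {v : n → K} (hv0 : v ≠ 0) (hv : herm σ ν v v = 0) :
    ∃ b, ν b ≠ b ∧ v b ≠ 0 := by
  by_contra! h
  obtain ⟨z, hz⟩ := Function.ne_iff.1 hv0
  have hνz : ν z = z := by_contra fun h' => hz (h z h')
  rw [herm_eq_sum, Finset.sum_eq_single z, hνz] at hv
  · exact hz (by simpa [formWeight_ne_zero hq z] using hv)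
  · intro b _ hb
    rw [h b fun h' => hb (hZ _ _ h' hνz), map_zero, zero_mul]
  · simp

theorem exists_apply_eq_one_of_apply_ne_zero {F : Set n} (hF : ∀ d ∈ F, ν d ∈ F)
    (hν : Function.Involutive ν) {a b : n} (haF : a ∉ F) (ha : ν a ≠ a) (hb : ν b ≠ b)
    (hab : a ≠ b) (hab' : ν a ≠ b) {v : n → K} (hvF : ∀ d ∈ F, v d = 0) (hvb : v b ≠ 0) :
    ∃ g ∈ fixing σ ν F, (g *ᵥ v) a = 1 := by
  refine ⟨_, root_mem_fixing ha hb hab hab' ((1 - v a) / v b) (fun h => hvb (hvF b h))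
    (fun h => haF (by simpa [hν a] using hF _ h)), ?_⟩
  have : a ≠ ν b := fun h => hab' (by rw [h, hν])
  rw [root_mulVec_apply, if_pos rfl, if_neg this, div_mul_cancel₀ _ hvb]
  ring

/-- A nonzero entry outside the pair of `a` lets the entry at `a` be adjusted at will. If `v j = 0`
and the nonzero entry found lies in the pair of `a`, it is first added to the entry at `j`, and `j`
then takes its place. -/
theorem exists_apply_eq_one (hσ : ∀ x, σ (σ x) = x) (hν : Function.Involutive ν)
    (hq : ∀ a, ν a = a → (2 : K) ≠ 0) (hZ : ∀ y z, ν y = y → ν z = z → y = z)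
    {F : Set n} (hF : ∀ d ∈ F, ν d ∈ F) {a j : n} (haF : a ∉ F) (ha : ν a ≠ a)
    (hjF : j ∉ F) (hj : ν j ≠ j) (haj : a ≠ j) (haj' : ν a ≠ j) {v : n → K}
    (hvF : ∀ d ∈ F, v d = 0) (hv0 : v ≠ 0) (hv : herm σ ν v v = 0) :
    ∃ g ∈ fixing σ ν F, (g *ᵥ v) a = 1 := by
  have hF' : ∀ d, ν d ∈ F → d ∈ F := fun d hd => by simpa [hν d] using hF _ hd
  obtain ⟨b, hb, hvb⟩ := exists_apply_ne_zero hq hZ hv0 hv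
  by_cases hvj : v j = 0
  · by_cases hab : a ≠ b ∧ ν a ≠ b
    · exact exists_apply_eq_one_of_apply_ne_zero hF hν haF ha hb hab.1 hab.2 hvF hvb
    have hjb : j ≠ b := fun h => hvb (h ▸ hvj)
    have hjb' : ν j ≠ b := by
      rintro rfl
      exact hab ⟨fun h => haj' (by rw [h, hν]), fun h => haj (hν.injective h)⟩
    have hx := root_mem_fixing (σ := σ) hj hb hjb hjb' 1 (fun h => hvb (hvF b h))
      fun h => hjF (hF' _ h)
    obtain ⟨g, hg, hga⟩ := exists_apply_eq_one_of_apply_ne_zero (σ := σ) hF hν haF ha hj haj haj'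
      (v := (1 + single j b 1 - single (ν b) (ν j) (σ 1)) *ᵥ v)
      (fun d hd => by rw [mulVec_apply_of_mem_fixing hσ hν hq hx (hF d hd), hvF d hd])
      (by
        have : j ≠ ν b := fun h => hjb' (by rw [h, hν])
        rw [root_mulVec_apply, if_pos rfl, if_neg this, hvj]
        simpa using hvb)
    exact ⟨_, mul_mem hg hx, by rwa [← mulVec_mulVec]⟩
  · exact exists_apply_eq_one_of_apply_ne_zero hF hν haF ha hj haj haj' hvF hvj

/-! ### Reducing an isometry pair by pair. -/

/-- The entries of an isometry in the rows paired with a fixed basis vector vanish. -/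
theorem isometry_mulVec_single_apply {A : Matrix n n K} (hν : Function.Involutive ν)
    (hq : ∀ a, ν a = a → (2 : K) ≠ 0)
    (hA : conjT σ A * pairForm K ν * A = pairForm K ν) {d : n} {c : K} (hc : c ≠ 0)
    (hd : A *ᵥ Pi.single (ν d) 1 = Pi.single (ν d) c) {b : n} (hb : b ≠ d) :
    (A *ᵥ Pi.single b 1) d = 0 := by
  have h := herm_mulVec hA (Pi.single (ν d) 1) (Pi.single b 1)
  rw [hd, herm_single_left, herm_single_left, hν, Pi.single_eq_of_ne hb.symm] at h
  simpa [formWeight_ne_zero hq, hc] using h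

theorem herm_col_self {A : Matrix n n K} (hA : conjT σ A * pairForm K ν * A = pairForm K ν)
    {a : n} (ha : ν a ≠ a) : herm σ ν (A *ᵥ Pi.single a 1) (A *ᵥ Pi.single a 1) = 0 := by
  rw [herm_mulVec hA, herm_single_left, Pi.single_eq_of_ne ha]
  simp

theorem isometry_mulVec_ne_zero {A : Matrix n n K} (hν : Function.Involutive ν)
    (hq : ∀ a, ν a = a → (2 : K) ≠ 0)
    (hA : conjT σ A * pairForm K ν * A = pairForm K ν) (a : n) :
    A *ᵥ Pi.single a 1 ≠ 0 := by
  intro h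
  have h' := herm_mulVec hA (Pi.single (ν a) 1) (Pi.single a 1)
  rw [h, herm_single_left, hν] at h'
  simp [herm_eq_sum] at h'
  exact formWeight_ne_zero hq _ h'.symm

/-- If some column `A e_a` has nonzero entry `c` at `a`, then `A` can be made to act diagonally
on the hyperbolic plane spanned by `e_a` and `e_{ν a}`. -/
theorem exists_plane (hσ : ∀ x, σ (σ x) = x) (hν : Function.Involutive ν)
    (hq : ∀ a, ν a = a → (2 : K) ≠ 0)
    {F : Set n} (hF : ∀ d ∈ F, ν d ∈ F) {a : n} (haF : a ∉ F) (ha : ν a ≠ a)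
    {A : Matrix n n K} (hA : conjT σ A * pairForm K ν * A = pairForm K ν)
    (hAF : ∀ d ∈ F, A *ᵥ Pi.single d 1 = Pi.single d 1) {c : K} (hc : c ≠ 0)
    (hAa : (A *ᵥ Pi.single a 1) a = c) :
    ∃ g ∈ fixing σ ν F, (g * A) *ᵥ Pi.single a 1 = Pi.single a c ∧
      (g * A) *ᵥ Pi.single (ν a) 1 = Pi.single (ν a) (σ c)⁻¹ := by
  have hF' : ∀ d, ν d ∈ F → d ∈ F := fun d hd => by simpa [hν d] using hF _ hd
  have hνa : ν (ν a) ≠ ν a := fun h => ha (hν.injective h)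
  have hνaF : ν a ∉ F := fun h => haF (hF' _ h)
  have hz : ∀ (B : Matrix n n K), conjT σ B * pairForm K ν * B = pairForm K ν →
      (∀ d ∈ F, B *ᵥ Pi.single d 1 = Pi.single d 1) → ∀ b ∉ F, ∀ d ∈ F,
      (B *ᵥ Pi.single b 1) d = 0 := fun B hB hBF b hb d hd =>
    isometry_mulVec_single_apply hν hq hB one_ne_zero (hBF _ (hF d hd)) fun h => hb (h ▸ hd)
  obtain ⟨g, hg, hga⟩ := exists_clear hσ hν hq hF haF ha (by rwa [hAa] :
    (A *ᵥ Pi.single a 1) a ≠ 0) (hz A hA hAF a haF) (herm_col_self hA ha)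
  have hgF := fixing_anti σ ν (Set.subset_insert (ν a) F) hg
  rw [hAa, mulVec_mulVec] at hga
  have hB := isometry_mul (isometry_of_mem_closure hσ hν hg.1) hA
  have hBF : ∀ d ∈ F, (g * A) *ᵥ Pi.single d 1 = Pi.single d 1 := fun d hd => by
    rw [← mulVec_mulVec, hAF d hd, hgF.2 d hd]
  have hσc : σ c ≠ 0 := by simpa using hc
  -- The columns at `a` and `ν a` pair to 1 and the first is now `c • e_a`, so this entry is forced
  -- and can serve as the next pivot.
  have hw : ((g * A) *ᵥ Pi.single (ν a) 1) (ν a) = (σ c)⁻¹ := by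
    have h := herm_mulVec hB (Pi.single a 1) (Pi.single (ν a) 1)
    rw [hga, herm_single_left, herm_single_left, formWeight_of_ne ha, Pi.single_eq_same] at h
    refine eq_inv_of_mul_eq_one_right ?_
    simpa using h
  obtain ⟨g', hg', hga'⟩ := exists_clear hσ hν hq hF hνaF hνa (by rw [hw]; exact inv_ne_zero hσc :
    ((g * A) *ᵥ Pi.single (ν a) 1) (ν a) ≠ 0) (hz _ hB hBF _ hνaF) (herm_col_self hB hνa)
  -- Clearing from `ν a` fixes `e_{ν (ν a)} = e_a`, so the column at `a` survives.
  rw [hν] at hg'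
  refine ⟨g' * g, mul_mem (fixing_anti σ ν (Set.subset_insert a F) hg') hgF, ?_, ?_⟩
  · have : Pi.single a c = c • (Pi.single a 1 : n → K) := by simp [← Pi.single_smul']
    rw [Matrix.mul_assoc, ← mulVec_mulVec, hga, this, mulVec_smul, hg'.2 a (Set.mem_insert _ _)]
  · rw [Matrix.mul_assoc, ← mulVec_mulVec, hga', hw]

/-- The pair of `j` is excluded from `T` so that it remains available as auxiliary pair at every
stage of the induction. -/
theorem exists_fix_pairs (hσ : ∀ x, σ (σ x) = x) (hν : Function.Involutive ν)
    (hq : ∀ a, ν a = a → (2 : K) ≠ 0) (hZ : ∀ y z, ν y = y → ν z = z → y = z)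
    {j : n} (hj : ν j ≠ j) {A : Matrix n n K} (hA : conjT σ A * pairForm K ν * A = pairForm K ν)
    (T : Finset n) (hT : ∀ d ∈ T, ν d ≠ d ∧ d ≠ j ∧ d ≠ ν j) :
    ∃ g ∈ fixing σ ν ∅, ∀ d, d ∈ T ∨ ν d ∈ T → (g * A) *ᵥ Pi.single d 1 = Pi.single d 1 := by
  induction T using Finset.induction_on with
  | empty => exact ⟨1, one_mem _, by simp⟩
  | insert a T haT ih =>
    have hT' : ∀ d ∈ T, ν d ≠ d ∧ d ≠ j ∧ d ≠ ν j := fun d hd => hT d (Finset.mem_insert_of_mem hd)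
    obtain ⟨g, hg, hgT⟩ := ih hT'
    obtain ⟨ha, haj, haj'⟩ := hT a (Finset.mem_insert_self _ _)
    have haj'' : ν a ≠ j := fun h => haj' (by rw [← h, hν])
    -- `T` may contain both members of a pair; the second one needs no work.
    by_cases hνa : ν a ∈ T
    · refine ⟨g, hg, fun d hd => hgT d ?_⟩
      rw [Finset.mem_insert, Finset.mem_insert] at hd
      rcases hd with (rfl | hd) | (rfl | hd)
      · exact Or.inr hνa
      · exact Or.inl hd
      · rw [hν] at hνa
        exact Or.inl hνa
      · exact Or.inr hd
    have hB := isometry_mul (isometry_of_mem_closure hσ hν hg.1) hA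
    have hF : ∀ d ∈ {d | d ∈ T ∨ ν d ∈ T}, ν d ∈ {d | d ∈ T ∨ ν d ∈ T} := fun d hd => by
      simpa [hν d, or_comm] using hd
    have haF : a ∉ {d | d ∈ T ∨ ν d ∈ T} := by simp [haT, hνa]
    have hjF : j ∉ {d | d ∈ T ∨ ν d ∈ T} := by
      rintro (h | h)
      · exact (hT' _ h).2.1 rfl
      · exact (hT' _ h).2.2 rfl
    obtain ⟨x, hx, hxa⟩ := exists_apply_eq_one hσ hν hq hZ hF haF ha hjF hj haj haj''
      (v := (g * A) *ᵥ Pi.single a 1)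
      (fun d hd => isometry_mulVec_single_apply hν hq hB one_ne_zero (hgT _ (hF d hd))
        fun h => haF (h ▸ hd)) (isometry_mulVec_ne_zero hν hq hB a) (herm_col_self hB ha)
    have hC := isometry_mul (isometry_of_mem_closure hσ hν hx.1) hB
    have hCF : ∀ d ∈ {d | d ∈ T ∨ ν d ∈ T},
        (x * (g * A)) *ᵥ Pi.single d 1 = Pi.single d 1 := fun d hd => by
      rw [← mulVec_mulVec, hgT d hd, hx.2 d hd]
    obtain ⟨y, hy, hy1, hy2⟩ := exists_plane hσ hν hq hF haF ha hC hCF one_ne_zero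
      (by rw [← mulVec_mulVec, hxa])
    refine ⟨y * (x * g), mul_mem (fixing_anti σ ν (Set.empty_subset _) hy)
      (mul_mem (fixing_anti σ ν (Set.empty_subset _) hx) hg), fun d hd => ?_⟩
    rw [map_one, inv_one] at hy2
    rw [Matrix.mul_assoc, Matrix.mul_assoc]
    by_cases hd1 : d = a
    · rw [hd1, hy1]
    by_cases hd2 : d = ν a
    · rw [hd2, hy2]
    have hdF : d ∈ {d | d ∈ T ∨ ν d ∈ T} := by
      rw [Finset.mem_insert, Finset.mem_insert] at hd
      rcases hd with (h | h) | (h | h)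
      · exact absurd h hd1
      · exact Or.inl h
      · exact absurd (by rw [← h, hν]) hd2
      · exact Or.inr h
    rw [← mulVec_mulVec, hCF d hdF, hy.2 d hdF]

/-- Outside `F` only the pair of `j` and a possible fixed index remain. If the entry at `j` is 0,
isotropy forces a nonzero entry at `ν j`, and the long root element with a nonzero skew `s` carries
it to `j`. -/
theorem exists_apply_ne_zero_of_plane (hν : Function.Involutive ν)
    (hq : ∀ a, ν a = a → (2 : K) ≠ 0) (hZ : ∀ y z, ν y = y → ν z = z → y = z)
    {s : K} (hs0 : s ≠ 0) (hs : σ s = -s) {F : Set n} (hF : ∀ d ∈ F, ν d ∈ F)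
    {j : n} (hjF : j ∉ F) (hj : ν j ≠ j) (hFj : ∀ d, ν d ≠ d → d ≠ j → d ≠ ν j → d ∈ F)
    {v : n → K} (hvF : ∀ d ∈ F, v d = 0) (hv0 : v ≠ 0) (hv : herm σ ν v v = 0) :
    ∃ g ∈ fixing σ ν F, (g *ᵥ v) j ≠ 0 := by
  by_cases hvj : v j = 0
  · obtain ⟨b, hb, hvb⟩ := exists_apply_ne_zero hq hZ hv0 hv
    have hbj : b = ν j := by
      by_contra h
      exact hvb (hvF b (hFj b hb (fun h' => hvb (h' ▸ hvj)) h))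
    refine ⟨_, long_mem_fixing hj hs fun h => hjF (by simpa [hν j] using hF _ h), ?_⟩
    rw [long_mulVec_apply, if_pos rfl, hvj, zero_add, ← hbj]
    exact mul_ne_zero hs0 hvb
  · exact ⟨1, one_mem _, by rwa [one_mulVec]⟩

/-- Every isometry is reduced by root elements to a diagonal matrix with entries `1` outside
the fixed point of `ν` and one pair `j, ν j`. -/
theorem exists_mul_eq_diagonal (hσ : ∀ x, σ (σ x) = x) (hν : Function.Involutive ν)
    (hq : ∀ a, ν a = a → (2 : K) ≠ 0) (hZ : ∀ y z, ν y = y → ν z = z → y = z)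
    {s : K} (hs0 : s ≠ 0) (hs : σ s = -s)
    {j : n} (hj : ν j ≠ j) {A : Matrix n n K}
    (hA : conjT σ A * pairForm K ν * A = pairForm K ν) :
    ∃ g ∈ Submonoid.closure {x | RootElem σ ν x}, ∃ d : n → K, g * A = diagonal d ∧
      (∀ a, ν a ≠ a → a ≠ j → a ≠ ν j → d a = 1) ∧ d j ≠ 0 ∧ d (ν j) = (σ (d j))⁻¹ ∧
      ∀ z, ν z = z → d z * σ (d z) = 1 := by
  classical
  obtain ⟨g, hg, hgT⟩ := exists_fix_pairs hσ hν hq hZ hj hA {d | ν d ≠ d ∧ d ≠ j ∧ d ≠ ν j}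
    (by simp)
  have hF : ∀ d ∈ {d | ν d ≠ d ∧ d ≠ j ∧ d ≠ ν j}, ν d ∈ {d | ν d ≠ d ∧ d ≠ j ∧ d ≠ ν j} := by
    rintro d ⟨h1, h2, h3⟩
    exact ⟨fun h => h1 (hν.injective h), fun h => h3 (by rw [← h, hν]),
      fun h => h2 (hν.injective h)⟩
  have hgF : ∀ d ∈ {d | ν d ≠ d ∧ d ≠ j ∧ d ≠ ν j}, (g * A) *ᵥ Pi.single d 1 = Pi.single d 1 :=
    fun d hd => hgT d (Or.inl (by simpa using hd))
  have hjF : j ∉ {d | ν d ≠ d ∧ d ≠ j ∧ d ≠ ν j} := fun h => h.2.1 rfl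
  have hB := isometry_mul (isometry_of_mem_closure hσ hν hg.1) hA
  obtain ⟨x, hx, hxj⟩ := exists_apply_ne_zero_of_plane hν hq hZ hs0 hs hF hjF hj
    (v := (g * A) *ᵥ Pi.single j 1)
    (fun d h1 h2 h3 => ⟨h1, h2, h3⟩)
    (fun d hd => isometry_mulVec_single_apply hν hq hB one_ne_zero (hgF _ (hF d hd))
        fun h => hjF (h ▸ hd)) (isometry_mulVec_ne_zero hν hq hB j) (herm_col_self hB hj)
  have hC := isometry_mul (isometry_of_mem_closure hσ hν hx.1) hB
  have hCF : ∀ d ∈ {d | ν d ≠ d ∧ d ≠ j ∧ d ≠ ν j},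
      (x * (g * A)) *ᵥ Pi.single d 1 = Pi.single d 1 := fun d hd => by
    rw [← mulVec_mulVec, hgF d hd, hx.2 d hd]
  rw [mulVec_mulVec] at hxj
  obtain ⟨y, hy, hy1, hy2⟩ := exists_plane hσ hν hq hF hjF hj hC hCF hxj rfl
  have hD := isometry_mul (isometry_of_mem_closure hσ hν hy.1) hC
  have hDF : ∀ d ∈ {d | ν d ≠ d ∧ d ≠ j ∧ d ≠ ν j},
      (y * (x * (g * A))) *ᵥ Pi.single d 1 = Pi.single d 1 := fun d hd => by
    rw [← mulVec_mulVec, hCF d hd, hy.2 d hd]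
  have hmem : y * (x * g) ∈ Submonoid.closure {x | RootElem σ ν x} :=
    mul_mem hy.1 (mul_mem hx.1 hg.1)
  have hassoc : y * (x * g) * A = y * (x * (g * A)) := by simp only [Matrix.mul_assoc]
  generalize hc : ((x * (g * A)) *ᵥ Pi.single j 1) j = c at *
  generalize y * (x * (g * A)) = D at *
  have hσc : σ c ≠ 0 := by simpa using hxj
  have hentry : ∀ a b, (D *ᵥ Pi.single b 1) a = D a b := fun a b => by simp
  have hcol : ∀ d, ν d ≠ d → ∃ e, e ≠ 0 ∧ D *ᵥ Pi.single d 1 = Pi.single d e := by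
    intro d hd
    by_cases h1 : d = j
    · exact ⟨c, hxj, h1 ▸ hy1⟩
    by_cases h2 : d = ν j
    · exact ⟨(σ c)⁻¹, inv_ne_zero hσc, h2 ▸ hy2⟩
    exact ⟨1, one_ne_zero, hDF d ⟨hd, h1, h2⟩⟩
  -- Columns at non-fixed indices are already multiples of basis vectors, which settles row `a` when
  -- `a` is fixed. In the other rows, the entry at `a` vanishes by orthogonality to column `ν a`;
  -- this also covers the column of the fixed index.
  have hdiag : D = diagonal fun a => D a a := by
    ext a b
    by_cases hab : a = b
    · simp [hab]
    rw [diagonal_apply_ne _ hab, ← hentry]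
    by_cases ha : ν a = a
    · have hb : ν b ≠ b := fun h => hab (hZ _ _ ha h)
      obtain ⟨e, -, he⟩ := hcol b hb
      rw [he, Pi.single_eq_of_ne hab]
    · obtain ⟨e, he0, he⟩ := hcol (ν a) fun h => ha (hν.injective h)
      exact isometry_mulVec_single_apply hν hq hD he0 he (Ne.symm hab)
  have hDj : D j j = c := by rw [← hentry, hy1, Pi.single_eq_same]
  refine ⟨_, hmem, fun a => D a a, hassoc.trans hdiag, fun a h1 h2 h3 => ?_, ?_, ?_, ?_⟩
  · show D a a = 1
    rw [← hentry, hDF a ⟨h1, h2, h3⟩, Pi.single_eq_same]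
  · show D j j ≠ 0
    rwa [hDj]
  · show D (ν j) (ν j) = (σ (D j j))⁻¹
    rw [hDj, ← hentry, hy2, Pi.single_eq_same]
  · intro z hz
    have h := herm_mulVec hD (Pi.single z 1) (Pi.single z 1)
    have hDz : D *ᵥ Pi.single z 1 = Pi.single z (D z z) := by
      conv_lhs => rw [hdiag, diagonal_mulVec_single, mul_one]
    rw [hDz, herm_single_left, herm_single_left, hz, Pi.single_eq_same, Pi.single_eq_same,
      map_one, one_mul, mul_one] at h
    refine mul_left_cancel₀ (formWeight_ne_zero hq z) ?_
    linear_combination h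

/-- Every isometry is reduced by root elements to a diagonal matrix, with the same determinant, both
by elementary operations and as a factorization. -/
theorem exists_diagonal_reduction (hσ : ∀ x, σ (σ x) = x) (hν : Function.Involutive ν)
    (hq : ∀ a, ν a = a → (2 : K) ≠ 0) (hZ : ∀ y z, ν y = y → ν z = z → y = z)
    {s : K} (hs0 : s ≠ 0) (hs : σ s = -s)
    {j : n} (hj : ν j ≠ j) {A : Matrix n n K}
    (hA : conjT σ A * pairForm K ν * A = pairForm K ν) {E : Matrix n n K → Prop}
    (hE : ∀ x, RootElem σ ν x → E x) :
    ∃ d : n → K, ((∀ a, ν a ≠ a → a ≠ j → a ≠ ν j → d a = 1) ∧ d j ≠ 0 ∧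
      d (ν j) = (σ (d j))⁻¹ ∧ ∀ z, ν z = z → d z * σ (d z) = 1) ∧
      ∏ a, d a = A.det ∧ Relation.ReflTransGen (ElemOp E) A (diagonal d) ∧
      ∃ L : List (Matrix n n K), (∀ x ∈ L, E x) ∧ A = L.prod * diagonal d := by
  obtain ⟨g, hg, d, hgA, hd⟩ := exists_mul_eq_diagonal hσ hν hq hZ hs0 hs hj hA
  -- Quantifying over `B` lets the induction treat `(x * y) * B` as `x` acting on `y * B`.
  suffices ∀ B : Matrix n n K, (g * B).det = B.det ∧ Relation.ReflTransGen (ElemOp E) B (g * B) ∧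
      ∃ L : List (Matrix n n K), (∀ x ∈ L, E x) ∧ B = L.prod * (g * B) by
    have := this A
    rw [hgA, det_diagonal] at this
    exact ⟨d, hd, this⟩
  clear hgA
  induction hg using Submonoid.closure_induction with
  | mem x hx =>
    intro B
    obtain ⟨y, hy, hxy⟩ := hx.exists_inv hν
    refine ⟨by rw [det_mul, hx.det_eq_one hν, one_mul], .single ⟨x, hE x hx, Or.inl rfl⟩,
      [y], by simpa using hE y hy, ?_⟩
    rw [List.prod_singleton, ← Matrix.mul_assoc, mul_eq_one_comm.1 hxy, Matrix.one_mul]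
  | one => exact fun B => ⟨by simp, by simpa using .refl, [], by simp⟩
  | mul x y _ _ hx hy =>
    intro B
    obtain ⟨h1, h2, L, hL, h3⟩ := hy B
    obtain ⟨h1', h2', L', hL', h3'⟩ := hx (y * B)
    rw [Matrix.mul_assoc]
    refine ⟨h1'.trans h1, h2.trans h2', L ++ L', ?_, ?_⟩
    · intro z hz
      exact (List.mem_append.1 hz).elim (hL z) (hL' z)
    · rw [List.prod_append, Matrix.mul_assoc, ← h3', ← h3]

end Reduction

/-! ### The two split unitary groups as instances. -/

section Specialization

variable {k K : Type*} [Field k] [Field K] [Algebra k K] {l : ℕ}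

theorem pairForm_swap : pairForm K (Sum.swap : EvenIndex l → EvenIndex l) = evenForm K l := by
  ext i j
  rcases i with i | i <;> rcases j with j | j <;>
    simp [pairForm, formWeight, evenForm, one_apply, eq_comm]

/-- The involution `a ↦ -a` of `OddIndex l`. -/
def oddNeg (l : ℕ) : OddIndex l → OddIndex l := Sum.map id Sum.swap

theorem oddNeg_involutive : Function.Involutive (oddNeg l) := by
  rintro (a | a | a) <;> rfl

theorem eq_zero_of_oddNeg_eq {a : OddIndex l} (h : oddNeg l a = a) : a = OddIndex.zero := by
  rcases a with a | a | a
  · rfl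
  all_goals simp [oddNeg] at h

theorem pairForm_oddNeg : pairForm K (oddNeg l) = oddForm K l := by
  ext i j
  rcases i with i | i | i <;> rcases j with j | j | j <;>
    simp [pairForm, formWeight, oddForm, oddNeg, one_apply, eq_comm]

variable {σ : K ≃ₐ[k] K}

/-- The pair `(a, b)` with parameter `t` and the pair `(ν b, ν a)` with parameter `-σ t` give the
same root element. This accounts for the condition `i < j` and for the absence of a separate family
on two negative indices. -/
theorem RootElem.evenElem (hσ : ∀ x, σ (σ x) = x) {x : Matrix (EvenIndex l) (EvenIndex l) K}
    (hx : RootElem σ Sum.swap x) : EvenElem σ l x := by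
  cases hx with
  | root a b ha hb hab hab' t =>
    rcases a with i | i <;> rcases b with j | j
    · exact .pos_pos i j (fun h => hab (h ▸ rfl)) t
    · rcases lt_trichotomy i j with h | h | h
      · exact .pos_neg i j h t
      · exact absurd (h ▸ rfl) hab'
      · simpa [hσ, ← single_neg, sub_eq_add_neg, add_right_comm] using
          EvenElem.pos_neg (σ := σ) j i h (-σ t)
    · rcases lt_trichotomy i j with h | h | h
      · exact .neg_pos i j h t
      · exact absurd (h ▸ rfl) hab'
      · simpa [hσ, ← single_neg, sub_eq_add_neg, add_right_comm] using
          EvenElem.neg_pos (σ := σ) j i h (-σ t)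
    · simpa [hσ, ← single_neg, sub_eq_add_neg, add_right_comm] using
        EvenElem.pos_pos (σ := σ) j i (fun h => hab (h ▸ rfl)) (-σ t)
  | long a ha s hs =>
    rcases a with i | i
    · exact .pos_neg_self i s hs
    · exact .neg_pos_self i s hs
  | short z a hz ha t => rcases z with z | z <;> simp at hz

theorem RootElem.oddElem (hσ : ∀ x, σ (σ x) = x) {x : Matrix (OddIndex l) (OddIndex l) K}
    (hx : RootElem σ (oddNeg l) x) : OddElem σ l x := by
  cases hx with
  | root a b ha hb hab hab' t =>
    rcases a with z | i | i
    · exact absurd rfl ha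
    all_goals rcases b with z | j | j
    · exact absurd rfl hb
    · exact .pos_pos i j (fun h => hab (h ▸ rfl)) t
    · rcases lt_trichotomy i j with h | h | h
      · exact .pos_neg i j h t
      · exact absurd (h ▸ rfl) hab'
      · simpa [oddNeg, hσ, ← single_neg, sub_eq_add_neg, add_right_comm] using
          OddElem.pos_neg (σ := σ) j i h (-σ t)
    · exact absurd rfl hb
    · rcases lt_trichotomy i j with h | h | h
      · exact .neg_pos i j h t
      · exact absurd (h ▸ rfl) hab'
      · simpa [oddNeg, hσ, ← single_neg, sub_eq_add_neg, add_right_comm] using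
          OddElem.neg_pos (σ := σ) j i h (-σ t)
    · simpa [oddNeg, hσ, ← single_neg, sub_eq_add_neg, add_right_comm] using
        OddElem.pos_pos (σ := σ) j i (fun h => hab (h ▸ rfl)) (-σ t)
  | long a ha s hs =>
    rcases a with z | i | i
    · exact absurd rfl ha
    · exact .pos_neg_self i s hs
    · exact .neg_pos_self i s hs
  | short z a hz ha t =>
    obtain rfl := eq_zero_of_oddNeg_eq hz
    rcases a with z | i | i
    · exact absurd rfl ha
    · exact .pos_zero i t
    · rw [sub_add_eq_add_sub]
      exact .zero_pos i t

/-- The difference `σ x - x` at a moved `x` works in every characteristic, including 2. -/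
theorem exists_skew (hσ : ∀ x, σ (σ x) = x) (hσ1 : σ ≠ 1) : ∃ s, s ≠ 0 ∧ σ s = -s := by
  obtain ⟨x, hx⟩ : ∃ x, σ x ≠ x := by
    by_contra! h
    exact hσ1 (AlgEquiv.ext h)
  exact ⟨σ x - x, sub_ne_zero.2 hx, by rw [map_sub, hσ, neg_sub]⟩

theorem prod_ite_last (hl : 0 < l) (c : K) :
    ∏ i : Fin l, (if (i : ℕ) + 1 = l then c else 1) = c := by
  rw [Finset.prod_eq_single (⟨l - 1, by omega⟩ : Fin l)]
  · exact if_pos (by simp; omega)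
  · intro b _ hb
    exact if_neg fun h => hb (Fin.ext (by simp; omega))
  · simp

end Specialization

end SplitUnitary

/-! ### The theorem for both parities. -/

open SplitUnitary in
theorem theoremA {k K : Type*} [Field k] [Field K] [Algebra k K]
    [Algebra.IsQuadraticExtension k K] (σ : K ≃ₐ[k] K) (hσ : orderOf σ = 2)
    (l : ℕ) (hl : 2 ≤ l) :
    -- order `d = 2l`, every characteristic
    (∀ A : Matrix.GeneralLinearGroup (SplitUnitary.EvenIndex l) K, A ∈ SplitUnitary.evenU σ l →
      ∃ c : K, c ≠ 0 ∧
        c * (σ c)⁻¹ = A.val.det ∧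
        Relation.ReflTransGen (SplitUnitary.ElemOp (SplitUnitary.EvenElem σ l))
          A.val (SplitUnitary.evenDiag σ l c) ∧
        ∃ L : List (Matrix (SplitUnitary.EvenIndex l) (SplitUnitary.EvenIndex l) K),
          (∀ x ∈ L, SplitUnitary.EvenElem σ l x) ∧
          A.val = L.prod * SplitUnitary.evenDiag σ l c) ∧
    -- order `d = 2l + 1`, characteristic different from 2
    ((2 : K) ≠ 0 →
      ∀ A : Matrix.GeneralLinearGroup (SplitUnitary.OddIndex l) K, A ∈ SplitUnitary.oddU σ l →
        ∃ a c : K, a * σ a = 1 ∧ c ≠ 0 ∧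
          a * c * (σ c)⁻¹ = A.val.det ∧
          Relation.ReflTransGen (SplitUnitary.ElemOp (SplitUnitary.OddElem σ l))
            A.val (SplitUnitary.oddDiag σ l a c) ∧
          ∃ L : List (Matrix (SplitUnitary.OddIndex l) (SplitUnitary.OddIndex l) K),
            (∀ x ∈ L, SplitUnitary.OddElem σ l x) ∧
            A.val = L.prod * SplitUnitary.oddDiag σ l a c) := by
  have hσσ : ∀ x, σ (σ x) = x := fun x => by
    have h : σ ^ 2 = 1 := hσ ▸ pow_orderOf_eq_one σ
    rw [pow_two] at h
    exact DFunLike.congr_fun h x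
  obtain ⟨s, hs0, hs⟩ := exists_skew hσσ (by rintro rfl; simp at hσ)
  -- Place `l` is the last element of `Fin l`, since `Fin l` counts from 0; its pair is the one kept
  -- in reserve.
  let m : Fin l := ⟨l - 1, by omega⟩
  have hm : ∀ i : Fin l, (i : ℕ) + 1 = l ↔ i = m := fun i => by
    rw [Fin.ext_iff]
    simp only [m]
    omega
  refine ⟨fun A hA => ?_, fun h2 A hA => ?_⟩
  · have hA' : conjT σ A.val * evenForm K l * A.val = evenForm K l := hA
    rw [← pairForm_swap] at hA'
    have hfix : ∀ a : EvenIndex l, a.swap ≠ a := by rintro (a | a) <;> simp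
    -- Without fixed indices the condition `2 ≠ 0` is vacuous, so characteristic 2 is allowed here.
    obtain ⟨d, ⟨h1, h0, hd, -⟩, hdet, hred⟩ := exists_diagonal_reduction hσσ Sum.swap_swap
      (fun a h => absurd h (hfix a)) (fun a _ h => absurd h (hfix a)) hs0 hs
      (hfix (EvenIndex.pos m)) hA' fun x hx => hx.evenElem hσσ
    have hD : Matrix.diagonal d = evenDiag σ l (d (EvenIndex.pos m)) := by
      refine congrArg Matrix.diagonal (funext ?_)
      rintro (i | i) <;> simp only [Sum.elim_inl, Sum.elim_inr, hm] <;> split_ifs with hi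
      · rw [hi]
      · exact h1 _ (hfix _) (by simpa using hi) (by simp)
      · rw [hi]
        exact hd
      · exact h1 _ (hfix _) (by simp) (by simpa using hi)
    rw [hD] at hred
    refine ⟨_, h0, ?_, hred⟩
    rw [← hdet, ← Matrix.det_diagonal, hD, evenDiag, Matrix.det_diagonal, Fintype.prod_sum_type]
    simp only [Sum.elim_inl, Sum.elim_inr, prod_ite_last (show 0 < l by omega)]
  · have hA' : conjT σ A.val * oddForm K l * A.val = oddForm K l := hA
    rw [← pairForm_oddNeg] at hA'
    have hfix : ∀ a : EvenIndex l, oddNeg l (Sum.inr a) ≠ Sum.inr a := by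
      rintro (a | a) <;> simp [oddNeg]
    obtain ⟨d, ⟨h1, h0, hd, hz⟩, hdet, hred⟩ := exists_diagonal_reduction hσσ oddNeg_involutive
      (fun _ _ => h2)
      (fun y z hy hz => (eq_zero_of_oddNeg_eq hy).trans (eq_zero_of_oddNeg_eq hz).symm) hs0 hs
      (hfix (EvenIndex.pos m)) hA' fun x hx => hx.oddElem hσσ
    have hD : Matrix.diagonal d = oddDiag σ l (d OddIndex.zero) (d (OddIndex.pos m)) := by
      refine congrArg Matrix.diagonal (funext ?_)
      rintro (_ | i | i)
      · rfl
      all_goals simp only [Sum.elim_inl, Sum.elim_inr, hm]; split_ifs with hi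
      · rw [hi]
      · exact h1 _ (hfix _) (by simpa using hi) (by simp [oddNeg])
      · rw [hi]
        exact hd
      · exact h1 _ (hfix _) (by simp) (by simpa [oddNeg] using hi)
    rw [hD] at hred
    refine ⟨_, _, hz _ rfl, h0, ?_, hred⟩
    rw [← hdet, ← Matrix.det_diagonal, hD, oddDiag, Matrix.det_diagonal, Fintype.prod_sum_type,
      Fintype.prod_sum_type]
    simp only [Sum.elim_inl, Sum.elim_inr, prod_ite_last (show 0 < l by omega),
      Finset.univ_unique, Finset.prod_singleton, mul_assoc]
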